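/- Let $G$ be a (finite-dimensional real) Lie group, $H\subseteq G$ a closed subgroup, $\mathfrak g,\mathfrak h$ their Lie algebras, and suppose that $G/H$ is reductive: $\mathfrak g=\mathfrak h\oplus\mathfrak m$ for a subspace $\mathfrak m$ with $\mathrm{Ad}(H)\mathfrak m\subseteq\mathfrak m$. Give $G/H$ the smooth structure for which $\pi:G\to G/H$, $\pi(g)=gH$, is a smooth submersion. Write $L_a$ for left translation by $a$ on $G$ and $\tau_a(gH)=agH$. Call $(L_g)_*\mathfrak m\subseteq T_gG$ the horizontal space at $g$; let $\mathbf h$ be the projection of $T_gG=(L_g)_*\mathfrak h\oplus(L_g)_*\mathfrak m$ onto it, let $\mathcal H$ be the horizontal lift (the inverse of $\pi_*:(L_g)_*\mathfrak m\to T_{\pi(g)}(G/H)$), and let $X^h(g)=\mathcal H(X(\pi(g)))\in T_gG$ for a vector field $X$ on $G/H$. For $A\in\mathfrak m$ let $\tilde A(g)=(L_g)_*A$; given a smooth local section $s$ of $\pi$, let $A_*(x)=(\tau_{s(x)})_*\pi_*A$ be the corresponding local vector field on $G/H$. Let $\nabla^{G}$ and $\nabla^{G/H}$ be smooth affine connections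 on $G$ and $G/H$ such that $\pi$ is an affine submersion with horizontal distribution, that is: for every $g\in G$ there is a smooth local section $s$ of $\pi$ near $\pi(g)$, with $s(\pi(g))=g$ and with the image of $s_*$ at $\pi(g)$ horizontal (for instance $g\exp(u)H\mapsto g\exp(u)$, $u\in\mathfrak m$ near $0$), such that for all $A,B\in\mathfrak m$ $$\mathbf h\big(\nabla^{G}_{\tilde A}\tilde B\big)(g)=\mathcal H\big((\nabla^{G/H}_{A_*}B_*)(\pi(g))\big)\in T_gG .$$ Then: 1. for all smooth vector fields $X,Y$ on $G/H$ one has $\mathbf h(\nabla^{G}_{X^h}Y^h)=\mathcal H(\nabla^{G/H}_XY)$ on $G$; 2. the second fundamental form $\beta_\pi(U,V)=(\pi^*\nabla^{G/H})_U(\pi_*V)-\pi_*(\nabla^G_UV)$ of $\pi$, where $\pi^*\nabla^{G/H}$ is the pull-back connection on vector fields along $\pi$, satisfies $\beta_\pi(U,V)=0$ for all smooth horizontal vector fields $U,V$ on $G$. -/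

import Mathlib

open Set Filter Function
open scoped Manifold ContDiff Topology Bundle

noncomputable section

namespace ReductiveSpace

/-! ### Sections along a map and the second fundamental form -/

section SecondFundamentalForm

variable {E : Type*} [NormedAddCommGroup E] [NormedSpace ℝ E]
  {F : Type*} [NormedAddCommGroup F] [NormedSpace ℝ F]
  {M : Type*} [TopologicalSpace M] [ChartedSpace E M] [IsManifold 𝓘(ℝ, E) ∞ M]
  {N : Type*} [TopologicalSpace N] [ChartedSpace F N] [IsManifold 𝓘(ℝ, F) ∞ N]

/-- A Koszul connection on the tangent bundle of `M`. The value `(∇_X Y)(x)` is written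
`cov Y x (X x)`. -/
abbrev AffineConnection (E : Type*) [NormedAddCommGroup E] [NormedSpace ℝ E]
    (M : Type*) [TopologicalSpace M] [ChartedSpace E M] [IsManifold 𝓘(ℝ, E) ∞ M] :=
  CovariantDerivative 𝓘(ℝ, E) E (fun x : M ↦ TangentSpace 𝓘(ℝ, E) x)

/-- The vector field on `N` which has the constant value `w` in the standard trivialization of the
tangent bundle around `y₀` (and which vanishes outside the domain of that trivialization). -/
def constField (y₀ : N) (w : F) (y : N) : TangentSpace 𝓘(ℝ, F) y :=
  (trivializationAt F (fun y : N ↦ TangentSpace 𝓘(ℝ, F) y) y₀).symmL ℝ y w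

/-- The fibre coordinate of a vector field `W` along `f : M → N`, in the standard trivialization of
the tangent bundle of `N` around `y₀`. -/
def fibreCoord (f : M → N) (W : ∀ q : M, TangentSpace 𝓘(ℝ, F) (f q)) (y₀ : N) (q : M) : F :=
  (trivializationAt F (fun y : N ↦ TangentSpace 𝓘(ℝ, F) y) y₀ ⟨f q, W q⟩).2

/-- The pull-back connection `f^*∇`: the derivative at `p`, in the direction `v`, of a vector field
`W` along `f : M → N`. If `W = ∑ᵢ wᵢ (Zᵢ ∘ f)`, where `(Zᵢ)` is the local frame of `TN` given by the
standard trivialization around `f p`, this is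
`∑ᵢ (v wᵢ) Zᵢ (f p) + ∑ᵢ wᵢ(p) (∇_{f_* v} Zᵢ) (f p)`. -/
def pullbackCov (cov : AffineConnection F N) (f : M → N)
    (W : ∀ q : M, TangentSpace 𝓘(ℝ, F) (f q)) (p : M) (v : TangentSpace 𝓘(ℝ, E) p) :
    TangentSpace 𝓘(ℝ, F) (f p) :=
  constField (F := F) (f p) (mfderiv 𝓘(ℝ, E) 𝓘(ℝ, F) (fibreCoord f W (f p)) p v) (f p)
    + cov (constField (f p) (fibreCoord f W (f p) p)) (f p) (mfderiv 𝓘(ℝ, E) 𝓘(ℝ, F) f p v)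

/-- The second fundamental form `β_f(U, V) = (f^*∇^N)_U (f_* V) - f_* (∇^M_U V)` of a map
`f : M → N`, evaluated at `p`. -/
def secondFundForm (covM : AffineConnection E M) (covN : AffineConnection F N) (f : M → N)
    (U V : ∀ q : M, TangentSpace 𝓘(ℝ, E) q) (p : M) : TangentSpace 𝓘(ℝ, F) (f p) :=
  pullbackCov covN f (fun q ↦ mfderiv 𝓘(ℝ, E) 𝓘(ℝ, F) f q (V q)) p (U p)
    - mfderiv 𝓘(ℝ, E) 𝓘(ℝ, F) f p (covM V p (U p))

end SecondFundamentalForm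

/-! ### Lie algebras and reductive decompositions -/

section Reductive

variable {E : Type*} [NormedAddCommGroup E] [NormedSpace ℝ E]
  {G : Type*} [TopologicalSpace G] [ChartedSpace E G] [Group G]

/-- The Lie algebra of a closed subgroup `H` of `G`: the vectors whose one-parameter subgroup
`t ↦ exp (t u)` (the integral curve through `1` of the left invariant vector field of `u`) lies in
`H`. These vectors already form a subspace; the span is taken to have it as a `Submodule`. -/
def subgroupLieAlgebra (H : Subgroup G) : Submodule ℝ (GroupLieAlgebra 𝓘(ℝ, E) G) :=
  Submodule.span ℝ {u | ∃ γ : ℝ → G, γ 0 = 1 ∧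
    IsMIntegralCurve γ (mulInvariantVectorField (I := 𝓘(ℝ, E)) u) ∧ ∀ t, γ t ∈ H}

/-- The adjoint action of `a : G` on the Lie algebra: the derivative at `1` of `x ↦ a x a⁻¹`. -/
def adjoint (a : G) (u : GroupLieAlgebra 𝓘(ℝ, E) G) : GroupLieAlgebra 𝓘(ℝ, E) G :=
  mfderiv 𝓘(ℝ, E) 𝓘(ℝ, E) (fun x : G ↦ a * x * a⁻¹) 1 u

/-- `𝔤 = 𝔥 ⊕ 𝔪` and `Ad(H) 𝔪 ⊆ 𝔪`. -/
structure IsReductive (H : Subgroup G) (m : Submodule ℝ (GroupLieAlgebra 𝓘(ℝ, E) G)) : Prop where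
  isCompl : IsCompl m (subgroupLieAlgebra H)
  adjoint_mem : ∀ a ∈ H, ∀ u ∈ m, adjoint a u ∈ m

/-- The subspace `(L_g)_* 𝔪` of `T_g G`. -/
def horizontalSpace (m : Submodule ℝ (GroupLieAlgebra 𝓘(ℝ, E) G)) (g : G) :
    Set (TangentSpace 𝓘(ℝ, E) g) :=
  {v | ∃ u ∈ m, mulInvariantVectorField (I := 𝓘(ℝ, E)) u g = v}

/-- The horizontal projection `T_g G → (L_g)_* 𝔪` along `(L_g)_* 𝔥`. -/
def horizontalProj {H : Subgroup G} {m : Submodule ℝ (GroupLieAlgebra 𝓘(ℝ, E) G)}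
    (hm : IsReductive H m) (g : G) (v : TangentSpace 𝓘(ℝ, E) g) : TangentSpace 𝓘(ℝ, E) g :=
  mulInvariantVectorField (I := 𝓘(ℝ, E)) (m.projection (subgroupLieAlgebra H) hm.isCompl
    (mfderiv 𝓘(ℝ, E) 𝓘(ℝ, E) (fun x : G ↦ g⁻¹ * x) g v : GroupLieAlgebra 𝓘(ℝ, E) G)) g

end Reductive

/-! ### The homogeneous space -/

section Quotient

variable {E : Type*} [NormedAddCommGroup E] [NormedSpace ℝ E]
  {F : Type*} [NormedAddCommGroup F] [NormedSpace ℝ F]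
  {G : Type*} [TopologicalSpace G] [ChartedSpace E G] [Group G]
  {H : Subgroup G} [ChartedSpace F (G ⧸ H)]

/-- The natural projection `π : G → G ⧸ H`. -/
def proj (H : Subgroup G) (g : G) : G ⧸ H := QuotientGroup.mk g

/-- The derivative `π_*` of the natural projection at `g`. -/
def projDeriv (E : Type*) [NormedAddCommGroup E] [NormedSpace ℝ E]
    (F : Type*) [NormedAddCommGroup F] [NormedSpace ℝ F]
    {G : Type*} [TopologicalSpace G] [ChartedSpace E G] [Group G]
    (H : Subgroup G) [ChartedSpace F (G ⧸ H)] (g : G) :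
    TangentSpace 𝓘(ℝ, E) g →L[ℝ] TangentSpace 𝓘(ℝ, F) (proj H g) :=
  mfderiv 𝓘(ℝ, E) 𝓘(ℝ, F) (proj H) g

/-- The horizontal lift `𝓗` to the point `g`: the inverse of the restriction of `π_*` to the
horizontal subspace of `T_g G`. -/
def horizontalLift (m : Submodule ℝ (GroupLieAlgebra 𝓘(ℝ, E) G)) (g : G)
    (w : TangentSpace 𝓘(ℝ, F) (proj H g)) : TangentSpace 𝓘(ℝ, E) g :=
  haveI : Nonempty (horizontalSpace m g) := ⟨⟨_, 0, m.zero_mem, rfl⟩⟩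
  (invFun (fun v : horizontalSpace m g ↦ projDeriv E F H g v) w : horizontalSpace m g)

/-- The horizontal lift `X^h` of a vector field `X` on `G ⧸ H`. -/
def horizontalLiftField (m : Submodule ℝ (GroupLieAlgebra 𝓘(ℝ, E) G))
    (X : ∀ x : G ⧸ H, TangentSpace 𝓘(ℝ, F) x) (g : G) : TangentSpace 𝓘(ℝ, E) g :=
  horizontalLift (H := H) m g (X (proj H g))

/-- `s` is a smooth local cross-section of `π` near `π g`, with `s (π g) = g`, whose image is
tangent to the horizontal distribution at `g`. -/
structure IsHorizontalSectionAt (m : Submodule ℝ (GroupLieAlgebra 𝓘(ℝ, E) G)) (g : G)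
    (s : G ⧸ H → G) : Prop where
  contMDiffAt : ContMDiffAt 𝓘(ℝ, F) 𝓘(ℝ, E) ∞ s (proj H g)
  proj_section : ∀ᶠ x in 𝓝 (proj H g), proj H (s x) = x
  section_proj : s (proj H g) = g
  mfderiv_mem : ∀ w : TangentSpace 𝓘(ℝ, F) (proj H g),
    mfderiv 𝓘(ℝ, F) 𝓘(ℝ, E) s (proj H g) w ∈ horizontalSpace m (s (proj H g))

/-- The vector field `A_*(x) = (τ_a)_* (π_* A)`, where `a = s x` is the representative of the coset
`x` given by a local cross-section `s`, and `τ_a (g H) = a g H`. -/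
def starField (s : G ⧸ H → G) (A : GroupLieAlgebra 𝓘(ℝ, E) G) (x : G ⧸ H) :
    TangentSpace 𝓘(ℝ, F) x :=
  mfderiv 𝓘(ℝ, F) 𝓘(ℝ, F) (fun y : G ⧸ H ↦ s x • y) (proj H 1) (projDeriv E F H 1 A)

/-- `π` is an affine submersion with horizontal distribution:
`𝐡(∇^G_Ã B̃) = 𝓗(∇^{G/H}_{A_*} B_*)` on `G`, for all `A, B ∈ 𝔪`. Here `Ã` is the left invariant
vector field of `A`. The field `A_*` depends on the choice of representatives of the cosets;
for the equation at the point `g` they are chosen by a horizontal local cross-section through `g`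
(such as `g exp(u) H ↦ g exp(u)` for `u ∈ 𝔪` near `0`). -/
def IsAffineSubmersion [IsManifold 𝓘(ℝ, E) ∞ G] [IsManifold 𝓘(ℝ, F) ∞ (G ⧸ H)]
    {m : Submodule ℝ (GroupLieAlgebra 𝓘(ℝ, E) G)} (hm : IsReductive H m)
    (covG : AffineConnection E G) (covQ : AffineConnection F (G ⧸ H)) : Prop :=
  ∀ g : G, ∃ s : G ⧸ H → G, IsHorizontalSectionAt (F := F) m g s ∧ ∀ A ∈ m, ∀ B ∈ m,
    horizontalProj hm g (covG (mulInvariantVectorField B) g (mulInvariantVectorField A g))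
      = horizontalLift (H := H) m g
          (covQ (starField s B) (proj H g) (starField s A (proj H g)))

end Quotient

end ReductiveSpace

end

open ReductiveSpace

namespace ReductiveSpace

/-! ### Pull-back connections and the second fundamental form of a map. -/

section SecondFundamentalForm

variable {E : Type*} [NormedAddCommGroup E] [NormedSpace ℝ E]
  {F : Type*} [NormedAddCommGroup F] [NormedSpace ℝ F]
  {M : Type*} [TopologicalSpace M] [ChartedSpace E M]
  {N : Type*} [TopologicalSpace N] [ChartedSpace F N] [IsManifold 𝓘(ℝ, F) ∞ N]

/-! The second fundamental form `β` depends on `U` only through its value at `g`, and it is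
tensorial in `V` (`tensorialAt_secondFundForm`). At a point `g`, horizontal fields may therefore be
replaced by left invariant ones `Ã`, `B̃` with `A, B ∈ 𝔪`. Take the horizontal section `s` through
`g` given by the affine condition. Along `s` the field `π_* B̃` is exactly `B_*`, and `Ã g` is
tangent to `s`, so the pull-back derivative is `∇_{A_*} B_*` (`pullbackCov_of_section`). Applying
`π_*` to the affine condition gives the same value for `π_* (∇_Ã B̃)`, hence `β = 0`.

The first claim is the case `U = X^h`, `V = Y^h`. Since `π_* Y^h = Y ∘ π`, the pull-back term is
`∇_X Y`, and lifting `π_* (∇ Y^h) = ∇ Y` back to `G` turns `π_*` into the horizontal projection.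

Two facts support this. First, `π_*` is bijective on horizontal spaces: sections give surjectivity,
and injectivity holds because `ker π_*` at `1` lies in `𝔥`
(`mem_subgroupLieAlgebra_of_projDeriv_one_eq_zero`). Second, `Y^h` is differentiable
(`mdifferentiableAt_horizontalLiftField`), which tensoriality requires. -/

theorem constField_add (y₀ : N) (w w' : F) :
    constField y₀ (w + w') = constField y₀ w + constField y₀ w' := by
  funext y
  exact map_add _ w w'

theorem constField_smul (y₀ : N) (a : ℝ) (w : F) :
    constField y₀ (a • w) = a • constField y₀ w := by
  funext y
  exact map_smul _ a w

theorem trivializationAt_constField (y₀ : N) (w : F) {y : N}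
    (hy : y ∈ (trivializationAt F (fun y : N ↦ TangentSpace 𝓘(ℝ, F) y) y₀).baseSet) :
    (trivializationAt F (fun y : N ↦ TangentSpace 𝓘(ℝ, F) y) y₀ ⟨y, constField y₀ w y⟩).2 = w := by
  have := (trivializationAt F (fun y : N ↦ TangentSpace 𝓘(ℝ, F) y) y₀).continuousLinearMapAt_symmL
    (R := ℝ) hy w
  rwa [Bundle.Trivialization.continuousLinearMapAt_apply,
    Bundle.Trivialization.linearMapAt_apply, if_pos hy] at this

theorem constField_trivializationAt (y₀ : N) (z : TangentSpace 𝓘(ℝ, F) y₀) :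
    constField y₀ (trivializationAt F (fun y : N ↦ TangentSpace 𝓘(ℝ, F) y) y₀ ⟨y₀, z⟩).2 y₀
      = z := by
  have hy := FiberBundle.mem_baseSet_trivializationAt F (fun y : N ↦ TangentSpace 𝓘(ℝ, F) y) y₀
  have := (trivializationAt F (fun y : N ↦ TangentSpace 𝓘(ℝ, F) y) y₀).symmL_continuousLinearMapAt
    (R := ℝ) hy z
  rwa [Bundle.Trivialization.continuousLinearMapAt_apply,
    Bundle.Trivialization.linearMapAt_apply, if_pos hy] at this

theorem mdifferentiableAt_constField (y₀ : N) (w : F) :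
    MDifferentiableAt 𝓘(ℝ, F) 𝓘(ℝ, F).tangent
      (fun y ↦ (⟨y, constField y₀ w y⟩ : TangentBundle 𝓘(ℝ, F) N)) y₀ := by
  rw [mdifferentiableAt_section]
  refine (mdifferentiableAt_const (c := w)).congr_of_eventuallyEq ?_
  filter_upwards [(trivializationAt F (fun y : N ↦ TangentSpace 𝓘(ℝ, F) y)
    y₀).open_baseSet.mem_nhds (FiberBundle.mem_baseSet_trivializationAt F _ y₀)] with y hy
  exact trivializationAt_constField y₀ w hy

theorem mdifferentiableAt_fibreCoord {f : M → N} {W : ∀ q : M, TangentSpace 𝓘(ℝ, F) (f q)} {p : M}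
    (hW : MDifferentiableAt 𝓘(ℝ, E) 𝓘(ℝ, F).tangent
      (fun q ↦ (⟨f q, W q⟩ : TangentBundle 𝓘(ℝ, F) N)) p) :
    MDifferentiableAt 𝓘(ℝ, E) 𝓘(ℝ, F) (fibreCoord f W (f p)) p :=
  ((mdifferentiableAt_totalSpace _ _).1 hW).2

theorem fibreCoord_add_eventuallyEq {f : M → N} {p : M} (hf : ContinuousAt f p)
    (W W' : ∀ q : M, TangentSpace 𝓘(ℝ, F) (f q)) :
    fibreCoord f (fun q ↦ W q + W' q) (f p)
      =ᶠ[𝓝 p] fun q ↦ fibreCoord f W (f p) q + fibreCoord f W' (f p) q := by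
  filter_upwards [hf ((trivializationAt F (fun y : N ↦ TangentSpace 𝓘(ℝ, F) y)
    (f p)).open_baseSet.mem_nhds (FiberBundle.mem_baseSet_trivializationAt F _ (f p)))] with q hq
  exact ((trivializationAt F (fun y : N ↦ TangentSpace 𝓘(ℝ, F) y) (f p)).linear ℝ hq).map_add _ _

theorem fibreCoord_smul_eventuallyEq {f : M → N} {p : M} (hf : ContinuousAt f p)
    (g : M → ℝ) (W : ∀ q : M, TangentSpace 𝓘(ℝ, F) (f q)) :
    fibreCoord f (fun q ↦ g q • W q) (f p)
      =ᶠ[𝓝 p] fun q ↦ g q • fibreCoord f W (f p) q := by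
  filter_upwards [hf ((trivializationAt F (fun y : N ↦ TangentSpace 𝓘(ℝ, F) y)
    (f p)).open_baseSet.mem_nhds (FiberBundle.mem_baseSet_trivializationAt F _ (f p)))] with q hq
  exact ((trivializationAt F (fun y : N ↦ TangentSpace 𝓘(ℝ, F) y) (f p)).linear ℝ hq).map_smul _ _

theorem mvfderiv_congr_of_eventuallyEq {φ ψ : M → F} {p : M} (h : φ =ᶠ[𝓝 p] ψ) :
    mvfderiv 𝓘(ℝ, E) φ p = mvfderiv 𝓘(ℝ, E) ψ p := by
  ext v
  exact DFunLike.congr_fun (h.mfderiv_eq (I := 𝓘(ℝ, E)) (I' := 𝓘(ℝ, F))) v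

theorem pullbackCov_eq (cov : AffineConnection F N) (f : M → N)
    (W : ∀ q : M, TangentSpace 𝓘(ℝ, F) (f q)) (p : M) (v : TangentSpace 𝓘(ℝ, E) p) :
    pullbackCov cov f W p v
      = constField (F := F) (f p) (mvfderiv 𝓘(ℝ, E) (fibreCoord f W (f p)) p v) (f p)
        + cov (constField (f p) (fibreCoord f W (f p) p)) (f p)
            (mfderiv 𝓘(ℝ, E) 𝓘(ℝ, F) f p v) :=
  rfl

theorem pullbackCov_add (cov : AffineConnection F N) {f : M → N} {p : M}
    (hf : ContinuousAt f p) {W W' : ∀ q : M, TangentSpace 𝓘(ℝ, F) (f q)}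
    (hW : MDifferentiableAt 𝓘(ℝ, E) 𝓘(ℝ, F) (fibreCoord f W (f p)) p)
    (hW' : MDifferentiableAt 𝓘(ℝ, E) 𝓘(ℝ, F) (fibreCoord f W' (f p)) p)
    (v : TangentSpace 𝓘(ℝ, E) p) :
    pullbackCov cov f (fun q ↦ W q + W' q) p v
      = pullbackCov cov f W p v + pullbackCov cov f W' p v := by
  have h := fibreCoord_add_eventuallyEq hf W W'
  rw [pullbackCov_eq, pullbackCov_eq, pullbackCov_eq, mvfderiv_congr_of_eventuallyEq h,
    mvfderiv_fun_add hW hW', h.self_of_nhds, add_apply,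
    constField_add, constField_add,
    cov.isCovariantDerivativeOnUniv.add (mdifferentiableAt_constField _ _)
      (mdifferentiableAt_constField _ _)]
  simp only [Pi.add_apply, add_apply]
  abel

theorem pullbackCov_smul (cov : AffineConnection F N) {f : M → N} {p : M}
    (hf : ContinuousAt f p) {g : M → ℝ} {W : ∀ q : M, TangentSpace 𝓘(ℝ, F) (f q)}
    (hg : MDifferentiableAt 𝓘(ℝ, E) 𝓘(ℝ, ℝ) g p)
    (hW : MDifferentiableAt 𝓘(ℝ, E) 𝓘(ℝ, F) (fibreCoord f W (f p)) p)
    (v : TangentSpace 𝓘(ℝ, E) p) :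
    pullbackCov cov f (fun q ↦ g q • W q) p v
      = g p • pullbackCov cov f W p v + mvfderiv 𝓘(ℝ, E) g p v • W p := by
  have h := fibreCoord_smul_eventuallyEq hf g W
  have hc : constField (f p) (fibreCoord f W (f p) p) (f p) = W p :=
    constField_trivializationAt (f p) (W p)
  rw [pullbackCov_eq, pullbackCov_eq, mvfderiv_congr_of_eventuallyEq h,
    mvfderiv_fun_smul hg hW, h.self_of_nhds, add_apply,
    smul_apply, ContinuousLinearMap.smulRight_apply,
    constField_add, constField_smul, constField_smul, constField_smul,
    cov.isCovariantDerivativeOnUniv.smul_const _ (mdifferentiableAt_constField _ _)]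
  simp only [Pi.add_apply, Pi.smul_apply, smul_apply, hc, smul_add]
  abel

theorem fibreCoord_constField_eventuallyEq (y₀ : N) (w : F) :
    fibreCoord (fun y : N ↦ y) (constField y₀ w) y₀ =ᶠ[𝓝 y₀] fun _ ↦ w := by
  filter_upwards [(trivializationAt F (fun y : N ↦ TangentSpace 𝓘(ℝ, F) y)
    y₀).open_baseSet.mem_nhds (FiberBundle.mem_baseSet_trivializationAt F _ y₀)] with y hy
  exact trivializationAt_constField y₀ w hy

/-- Both sides obey the same Leibniz rule, so their difference is tensorial in `Z`. It can thus be
tested on the constant field with the same value at `y₀`, whose fibre coordinate has zero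
derivative. -/
theorem pullbackCov_id [FiniteDimensional ℝ F] (cov : AffineConnection F N)
    {Z : ∀ y : N, TangentSpace 𝓘(ℝ, F) y} {y₀ : N}
    (hZ : MDifferentiableAt 𝓘(ℝ, F) 𝓘(ℝ, F).tangent
      (fun y ↦ (⟨y, Z y⟩ : TangentBundle 𝓘(ℝ, F) N)) y₀) (w : TangentSpace 𝓘(ℝ, F) y₀) :
    pullbackCov cov (fun y : N ↦ y) Z y₀ w = cov Z y₀ w := by
  have htens : TensorialAt 𝓘(ℝ, F) F (fun Z : ∀ y : N, TangentSpace 𝓘(ℝ, F) y ↦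
      pullbackCov cov (fun y : N ↦ y) Z y₀ w - cov Z y₀ w) y₀ := by
    constructor
    · intro g σ hg hσ
      have h := pullbackCov_smul cov (f := fun y : N ↦ y) (W := σ) continuousAt_id hg
        (mdifferentiableAt_fibreCoord hσ) w
      have h' := DFunLike.congr_fun (cov.isCovariantDerivativeOnUniv.leibniz hσ hg) w
      simp only [add_apply, smul_apply,
        ContinuousLinearMap.smulRight_apply] at h'
      rw [smul_sub]
      refine (congrArg₂ (· - ·) h h').trans ?_
      abel
    · intro σ σ' hσ hσ'
      have h := pullbackCov_add cov (f := fun y : N ↦ y) (W := σ) (W' := σ') continuousAt_id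
        (mdifferentiableAt_fibreCoord hσ) (mdifferentiableAt_fibreCoord hσ') w
      have h' := DFunLike.congr_fun (cov.isCovariantDerivativeOnUniv.add hσ hσ') w
      simp only [add_apply] at h'
      refine (congrArg₂ (· - ·) h h').trans ?_
      abel
  have key := htens.pointwise hZ (mdifferentiableAt_constField y₀
    (trivializationAt F (fun y : N ↦ TangentSpace 𝓘(ℝ, F) y) y₀ ⟨y₀, Z y₀⟩).2)
    (constField_trivializationAt y₀ (Z y₀)).symm
  refine sub_eq_zero.1 (key.trans (sub_eq_zero.2 ?_))
  have hc := fibreCoord_constField_eventuallyEq y₀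
    (trivializationAt F (fun y : N ↦ TangentSpace 𝓘(ℝ, F) y) y₀ ⟨y₀, Z y₀⟩).2
  have hid : mfderiv 𝓘(ℝ, F) 𝓘(ℝ, F) (fun y : N ↦ y) y₀ w = w := by
    rw [show (fun y : N ↦ y) = id from rfl, mfderiv_id]; rfl
  rw [pullbackCov_eq, mvfderiv_congr_of_eventuallyEq hc, mvfderiv_const, hc.self_of_nhds, hid]
  have h0 : constField y₀ (0 : F) = 0 := by simpa using constField_smul y₀ (0 : ℝ) (0 : F)
  simp [h0]

theorem pullbackCov_comp [FiniteDimensional ℝ F] (cov : AffineConnection F N)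
    {f : M → N} {p : M} (hf : MDifferentiableAt 𝓘(ℝ, E) 𝓘(ℝ, F) f p)
    {Z : ∀ y : N, TangentSpace 𝓘(ℝ, F) y}
    (hZ : MDifferentiableAt 𝓘(ℝ, F) 𝓘(ℝ, F).tangent
      (fun y ↦ (⟨y, Z y⟩ : TangentBundle 𝓘(ℝ, F) N)) (f p)) (v : TangentSpace 𝓘(ℝ, E) p) :
    pullbackCov cov f (fun q ↦ Z (f q)) p v = cov Z (f p) (mfderiv 𝓘(ℝ, E) 𝓘(ℝ, F) f p v) := by
  have h : mfderiv 𝓘(ℝ, E) 𝓘(ℝ, F) (fibreCoord f (fun q ↦ Z (f q)) (f p)) p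
      = (mfderiv 𝓘(ℝ, F) 𝓘(ℝ, F) (fibreCoord (fun y : N ↦ y) Z (f p)) (f p)).comp
          (mfderiv 𝓘(ℝ, E) 𝓘(ℝ, F) f p) :=
    mfderiv_comp p (mdifferentiableAt_fibreCoord (f := fun y : N ↦ y) hZ) hf
  have hid : mfderiv 𝓘(ℝ, F) 𝓘(ℝ, F) (fun y : N ↦ y) (f p) = ContinuousLinearMap.id ℝ _ :=
    mfderiv_id
  rw [← pullbackCov_id cov hZ, pullbackCov, pullbackCov, h, hid]
  rfl

/-- If `W` restricts to `Z` along a local section `s` of `f`, and `v` is tangent to `s`, then the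
pull-back connection of `W` is the connection of `Z`. -/
theorem pullbackCov_of_section [FiniteDimensional ℝ F] (cov : AffineConnection F N)
    {f : M → N} {p : M} {s : N → M}
    (hs : MDifferentiableAt 𝓘(ℝ, F) 𝓘(ℝ, E) s (f p)) (hsp : s (f p) = p)
    {W : ∀ q : M, TangentSpace 𝓘(ℝ, F) (f q)}
    (hW : MDifferentiableAt 𝓘(ℝ, E) 𝓘(ℝ, F) (fibreCoord f W (f p)) p)
    {Z : ∀ y : N, TangentSpace 𝓘(ℝ, F) y}
    (hZ : MDifferentiableAt 𝓘(ℝ, F) 𝓘(ℝ, F).tangent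
      (fun y ↦ (⟨y, Z y⟩ : TangentBundle 𝓘(ℝ, F) N)) (f p))
    (hWZ : ∀ᶠ y in 𝓝 (f p),
      (⟨f (s y), W (s y)⟩ : TangentBundle 𝓘(ℝ, F) N) = ⟨y, Z y⟩)
    {v : TangentSpace 𝓘(ℝ, E) p}
    (hv : (mfderiv 𝓘(ℝ, F) 𝓘(ℝ, E) s (f p) (mfderiv 𝓘(ℝ, E) 𝓘(ℝ, F) f p v) : E) = v) :
    pullbackCov cov f W p v = cov Z (f p) (mfderiv 𝓘(ℝ, E) 𝓘(ℝ, F) f p v) := by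
  have hcoord : fibreCoord f W (f p) ∘ s =ᶠ[𝓝 (f p)] fibreCoord (fun y : N ↦ y) Z (f p) := by
    filter_upwards [hWZ] with y hy
    simp only [comp_apply, fibreCoord]
    rw [hy]
  -- Since `s_* f_* v = v`, the derivative of the coordinate of `W` in the direction `v` can be
  -- computed along `s`, where `W` is `Z`.
  have h : mfderiv 𝓘(ℝ, F) 𝓘(ℝ, F) (fibreCoord (fun y : N ↦ y) Z (f p)) (f p)
        (mfderiv 𝓘(ℝ, E) 𝓘(ℝ, F) f p v)
      = (mfderiv 𝓘(ℝ, E) 𝓘(ℝ, F) (fibreCoord f W (f p)) p v : F) := by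
    have h1 := DFunLike.congr_fun (mfderiv_comp_of_eq hW hs hsp) (mfderiv 𝓘(ℝ, E) 𝓘(ℝ, F) f p v)
    have h2 := DFunLike.congr_fun (hcoord.mfderiv_eq (I := 𝓘(ℝ, F)) (I' := 𝓘(ℝ, F)))
      (mfderiv 𝓘(ℝ, E) 𝓘(ℝ, F) f p v)
    refine h2.symm.trans (h1.trans ?_)
    have h3 : (mfderiv 𝓘(ℝ, E) 𝓘(ℝ, F) (fibreCoord f W (f p)) (s (f p)) : E →L[ℝ] F)
        = mfderiv 𝓘(ℝ, E) 𝓘(ℝ, F) (fibreCoord f W (f p)) p := by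
      rw [hsp]
    exact (DFunLike.congr_fun h3 _).trans
      (congrArg (mfderiv 𝓘(ℝ, E) 𝓘(ℝ, F) (fibreCoord f W (f p)) p) hv)
  have h0 : fibreCoord f W (f p) p = fibreCoord (fun y : N ↦ y) Z (f p) (f p) := by
    have := hcoord.self_of_nhds
    rwa [comp_apply, hsp] at this
  have hid : mfderiv 𝓘(ℝ, F) 𝓘(ℝ, F) (fun y : N ↦ y) (f p) = ContinuousLinearMap.id ℝ _ :=
    mfderiv_id
  rw [← pullbackCov_id cov hZ, pullbackCov, pullbackCov, h, h0, hid]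
  rfl

theorem mdifferentiableAt_mfderiv_apply [IsManifold 𝓘(ℝ, E) ∞ M]
    {f : M → N} (hf : ContMDiff 𝓘(ℝ, E) 𝓘(ℝ, F) ∞ f)
    {V : ∀ q : M, TangentSpace 𝓘(ℝ, E) q} {p : M}
    (hV : MDifferentiableAt 𝓘(ℝ, E) 𝓘(ℝ, E).tangent
      (fun q ↦ (⟨q, V q⟩ : TangentBundle 𝓘(ℝ, E) M)) p) :
    MDifferentiableAt 𝓘(ℝ, E) 𝓘(ℝ, F).tangent
      (fun q ↦ (⟨f q, mfderiv 𝓘(ℝ, E) 𝓘(ℝ, F) f q (V q)⟩ : TangentBundle 𝓘(ℝ, F) N)) p := by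
  have h : ContMDiff 𝓘(ℝ, E).tangent 𝓘(ℝ, F).tangent 1 (tangentMap 𝓘(ℝ, E) 𝓘(ℝ, F) f) :=
    hf.contMDiff_tangentMap (by norm_cast)
  exact (h.mdifferentiable one_ne_zero _).comp p hV

/-- When `V` is multiplied by a function `g`, both connections produce the term `(U g) • f_* V`, and
the two copies cancel. -/
theorem tensorialAt_secondFundForm [IsManifold 𝓘(ℝ, E) ∞ M]
    (covM : AffineConnection E M) (covN : AffineConnection F N)
    {f : M → N} (hf : ContMDiff 𝓘(ℝ, E) 𝓘(ℝ, F) ∞ f) (U : ∀ q : M, TangentSpace 𝓘(ℝ, E) q)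
    (p : M) :
    TensorialAt 𝓘(ℝ, E) E (fun V : ∀ q : M, TangentSpace 𝓘(ℝ, E) q ↦
      secondFundForm covM covN f U V p) p := by
  constructor
  · intro g V hg hV
    have h := pullbackCov_smul covN hf.continuous.continuousAt hg
      (mdifferentiableAt_fibreCoord (mdifferentiableAt_mfderiv_apply hf hV)) (U p)
    have h' := DFunLike.congr_fun (covM.isCovariantDerivativeOnUniv.leibniz hV hg) (U p)
    simp only [add_apply, smul_apply,
      ContinuousLinearMap.smulRight_apply] at h'
    simp only [secondFundForm]
    rw [h', map_add, map_smul, map_smul, smul_sub]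
    simp only [Pi.smul_apply', map_smul]
    rw [h]
    abel
  · intro V V' hV hV'
    have h := pullbackCov_add covN hf.continuous.continuousAt
      (mdifferentiableAt_fibreCoord (mdifferentiableAt_mfderiv_apply hf hV))
      (mdifferentiableAt_fibreCoord (mdifferentiableAt_mfderiv_apply hf hV')) (U p)
    have h' := DFunLike.congr_fun (covM.isCovariantDerivativeOnUniv.add hV hV') (U p)
    simp only [add_apply] at h'
    simp only [secondFundForm]
    rw [h', map_add]
    simp only [Pi.add_apply, map_add]
    rw [h]
    abel

end SecondFundamentalForm

/-- The intermediate point is a variable `y` and vectors live in the model spaces, so that base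
points such as `g⁻¹ * g` and `1` need no transport between tangent spaces. -/
theorem mfderiv_comp_apply_of_base_eq {E E' E'' : Type*} [NormedAddCommGroup E] [NormedSpace ℝ E]
    [NormedAddCommGroup E'] [NormedSpace ℝ E'] [NormedAddCommGroup E''] [NormedSpace ℝ E'']
    {M M' M'' : Type*} [TopologicalSpace M] [ChartedSpace E M] [TopologicalSpace M']
    [ChartedSpace E' M'] [TopologicalSpace M''] [ChartedSpace E'' M'']
    {f : M → M'} {g : M' → M''} {x : M} {y : M'} (hy : f x = y)
    (hg : MDifferentiableAt 𝓘(ℝ, E') 𝓘(ℝ, E'') g y)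
    (hf : MDifferentiableAt 𝓘(ℝ, E) 𝓘(ℝ, E') f x) (v : E) :
    (mfderiv 𝓘(ℝ, E) 𝓘(ℝ, E'') (g ∘ f) x v : E'')
      = mfderiv 𝓘(ℝ, E') 𝓘(ℝ, E'') g y (mfderiv 𝓘(ℝ, E) 𝓘(ℝ, E') f x v : E') := by
  subst hy
  exact mfderiv_comp_apply x hg hf v

theorem comp_one_smulRight {E F : Type*} [NormedAddCommGroup E] [NormedSpace ℝ E]
    [NormedAddCommGroup F] [NormedSpace ℝ F] (L : E →L[ℝ] F) (v : E) :
    L.comp ((1 : ℝ →L[ℝ] ℝ).smulRight v) = (1 : ℝ →L[ℝ] ℝ).smulRight (L v) := by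
  ext
  simp

/-! ### Left invariant fields and one-parameter subgroups. -/

section LieGroup

variable {E : Type*} [NormedAddCommGroup E] [NormedSpace ℝ E]
  {G : Type*} [TopologicalSpace G] [ChartedSpace E G] [Group G]

theorem mulInvariantVectorField_one (u : GroupLieAlgebra 𝓘(ℝ, E) G) :
    mulInvariantVectorField (I := 𝓘(ℝ, E)) u (1 : G) = u := by
  have h : (fun y : G ↦ 1 * y) = id := by funext y; simp
  rw [mulInvariantVectorField, h, mfderiv_id]
  rfl

variable [LieGroup 𝓘(ℝ, E) ∞ G]

theorem mdifferentiableAt_mul_left (a x : G) :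
    MDifferentiableAt 𝓘(ℝ, E) 𝓘(ℝ, E) (fun y : G ↦ a * y) x :=
  (contMDiff_mul_left (I := 𝓘(ℝ, E)) (n := ∞) (a := a)).mdifferentiable (by simp) x

theorem mulInvariantVectorField_mul (u : GroupLieAlgebra 𝓘(ℝ, E) G) (a b : G) :
    mulInvariantVectorField (I := 𝓘(ℝ, E)) u (a * b)
      = mfderiv 𝓘(ℝ, E) 𝓘(ℝ, E) (fun y : G ↦ a * y) b (mulInvariantVectorField u b) := by
  have h := mfderiv_comp_apply_of_base_eq (mul_one b) (mdifferentiableAt_mul_left (E := E) a b)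
    (mdifferentiableAt_mul_left b 1) u
  have hab : ((fun y : G ↦ a * y) ∘ fun y : G ↦ b * y) = fun y ↦ a * b * y := by
    funext y; simp [mul_assoc]
  rw [hab] at h
  exact h

theorem mfderiv_inv_mul_mulInvariantVectorField (u : GroupLieAlgebra 𝓘(ℝ, E) G) (g : G) :
    (mfderiv 𝓘(ℝ, E) 𝓘(ℝ, E) (fun x : G ↦ g⁻¹ * x) g (mulInvariantVectorField u g) : E) = u := by
  rw [← mulInvariantVectorField_mul, inv_mul_cancel, mulInvariantVectorField_one]

theorem mulInvariantVectorField_mfderiv_inv_mul (g : G) (v : TangentSpace 𝓘(ℝ, E) g) :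
    mulInvariantVectorField (I := 𝓘(ℝ, E))
      (mfderiv 𝓘(ℝ, E) 𝓘(ℝ, E) (fun x : G ↦ g⁻¹ * x) g v : GroupLieAlgebra 𝓘(ℝ, E) G) g = v := by
  have h := mfderiv_comp_apply_of_base_eq (inv_mul_cancel g)
    (mdifferentiableAt_mul_left (E := E) g 1) (mdifferentiableAt_mul_left g⁻¹ g) v
  have hid : ((fun y : G ↦ g * y) ∘ fun y : G ↦ g⁻¹ * y) = id := by
    funext y; simp
  rw [hid, mfderiv_id] at h
  exact h.symm

theorem contMDiff_mulInvariantVectorField_one (u : GroupLieAlgebra 𝓘(ℝ, E) G) :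
    ContMDiff 𝓘(ℝ, E) 𝓘(ℝ, E).tangent 1
      (fun g : G ↦ (⟨g, mulInvariantVectorField u g⟩ : TangentBundle 𝓘(ℝ, E) G)) := by
  have : LieGroup 𝓘(ℝ, E) (minSmoothness ℝ 3) G :=
    LieGroup.of_le (n := ∞) (by simp; norm_cast)
  exact (contMDiff_mulInvariantVectorField u).of_le (by simp)

/-- Left translates of a local integral curve through `1` are integral curves through every point
with the same lifetime `ε`, and a uniform lifetime makes the field complete. -/
theorem exists_isMIntegralCurve_mulInvariantVectorField [CompleteSpace E] [T2Space G]
    (u : GroupLieAlgebra 𝓘(ℝ, E) G) :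
    ∃ γ : ℝ → G, γ 0 = 1 ∧ IsMIntegralCurve γ (mulInvariantVectorField (I := 𝓘(ℝ, E)) u) := by
  have hu := contMDiff_mulInvariantVectorField_one u
  obtain ⟨γ, h0, hγ⟩ := exists_isMIntegralCurveAt_of_contMDiffAt_boundaryless (t₀ := 0)
    (hu.contMDiffAt (x := 1))
  obtain ⟨ε, hε, hγ⟩ := isMIntegralCurveAt_iff'.1 hγ
  refine exists_isMIntegralCurve_of_isMIntegralCurveOn hu hε (fun g ↦ ?_) 1
  refine ⟨fun t ↦ g * γ t, by simp [h0], fun t ht ↦ ?_⟩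
  have ht' : t ∈ Metric.ball (0 : ℝ) ε := by rwa [Real.ball_eq_Ioo, zero_sub, zero_add]
  have h := (mdifferentiableAt_mul_left g (γ t)).hasMFDerivAt.comp_hasMFDerivWithinAt t (hγ t ht')
  rw [Real.ball_eq_Ioo, zero_sub, zero_add] at h
  have e : (mfderiv 𝓘(ℝ, E) 𝓘(ℝ, E) (fun y : G ↦ g * y) (γ t)).comp
      ((1 : ℝ →L[ℝ] ℝ).smulRight (mulInvariantVectorField u (γ t)))
      = (1 : ℝ →L[ℝ] ℝ).smulRight (mulInvariantVectorField (I := 𝓘(ℝ, E)) u (g * γ t)) := by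
    rw [mulInvariantVectorField_mul]
    exact comp_one_smulRight (E := E) (F := E) _ _
  exact e ▸ h

/-- A curve with vanishing derivative is constant. -/
theorem eq_of_forall_hasMFDerivAt_zero {F : Type*} [NormedAddCommGroup F] [NormedSpace ℝ F]
    {N : Type*} [TopologicalSpace N] [T2Space N] [ChartedSpace F N] [IsManifold 𝓘(ℝ, F) ∞ N]
    {c : ℝ → N} (hc : ∀ t, HasMFDerivAt 𝓘(ℝ, ℝ) 𝓘(ℝ, F) c t 0) (t t' : ℝ) : c t = c t' := by
  have h0 : ContMDiff 𝓘(ℝ, F) 𝓘(ℝ, F).tangent 1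
      (fun x : N ↦ (⟨x, 0⟩ : TangentBundle 𝓘(ℝ, F) N)) :=
    Bundle.contMDiff_zeroSection ℝ _
  -- Both `c` and the constant curve at `c t'` integrate the zero field, so uniqueness of integral
  -- curves identifies them.
  have hcurve : IsMIntegralCurve c (fun x : N ↦ (0 : TangentSpace 𝓘(ℝ, F) x)) := by
    intro s
    have h : (1 : ℝ →L[ℝ] ℝ).smulRight (0 : TangentSpace 𝓘(ℝ, F) (c s)) = 0 := by
      ext
      simp
    rw [h]
    exact hc s
  exact congrFun (isMIntegralCurve_Ioo_eq_of_contMDiff_boundaryless (t₀ := t') h0 hcurve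
    (isMIntegralCurve_const (x := c t') rfl) rfl) t

end LieGroup

/-- The coset relation is the preimage of the closed set `H` under `(a, b) ↦ a⁻¹ b`, and the
quotient map is open. -/
theorem t2Space_quotient {G : Type*} [TopologicalSpace G] [Group G] [IsTopologicalGroup G]
    {H : Subgroup G} (hH : IsClosed (H : Set G)) :
    T2Space (G ⧸ H) := by
  rw [t2Space_iff_of_isOpenQuotientMap QuotientGroup.isOpenQuotientMap_mk]
  have : {q : G × G | (q.1 : G ⧸ H) = q.2} = (fun q : G × G ↦ q.1⁻¹ * q.2) ⁻¹' H := by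
    ext q
    exact QuotientGroup.eq
  rw [this]
  exact hH.preimage (by fun_prop)

/-! ### Equivariance of `π` and the kernel of its derivative. -/

section Quotient

variable {E : Type*} [NormedAddCommGroup E] [NormedSpace ℝ E]
  {F : Type*} [NormedAddCommGroup F] [NormedSpace ℝ F]
  {G : Type*} [TopologicalSpace G] [ChartedSpace E G] [Group G]
  {H : Subgroup G} [ChartedSpace F (G ⧸ H)]
  {m : Submodule ℝ (GroupLieAlgebra 𝓘(ℝ, E) G)}

theorem IsHorizontalSectionAt.mdifferentiableAt {g : G} {s : G ⧸ H → G}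
    (hs : IsHorizontalSectionAt (F := F) m g s) :
    MDifferentiableAt 𝓘(ℝ, F) 𝓘(ℝ, E) s (proj H g) :=
  hs.contMDiffAt.mdifferentiableAt (by simp)

variable (E F H) in
/-- The linear map `u ↦ π_* (L_g)_* u`. -/
noncomputable def invariantProjDeriv (g : G) : GroupLieAlgebra 𝓘(ℝ, E) G →ₗ[ℝ] F :=
  ((projDeriv E F H g : E →L[ℝ] F).comp
    (mfderiv 𝓘(ℝ, E) 𝓘(ℝ, E) (fun y : G ↦ g * y) 1 : E →L[ℝ] E)).toLinearMap

/-- A curve inside `H` has constant image under `π`. This handles the generators, and the kernel,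
being a subspace, contains their span. -/
theorem projDeriv_one_eq_zero_of_mem (hπ : ContMDiff 𝓘(ℝ, E) 𝓘(ℝ, F) ∞ (proj H))
    {u : GroupLieAlgebra 𝓘(ℝ, E) G} (hu : u ∈ subgroupLieAlgebra H) :
    projDeriv E F H 1 u = 0 := by
  refine (Submodule.span_le (p := LinearMap.ker (projDeriv E F H 1).toLinearMap)).2 ?_ hu
  rintro v ⟨γ, h0, hγ, hH⟩
  have hconst : proj H ∘ γ = fun _ ↦ proj H 1 := by
    funext t
    exact QuotientGroup.eq.2 (by simpa using hH t)
  have hγ0 := (hγ 0).mfderiv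
  have h := mfderiv_comp_apply_of_base_eq h0 (hπ.mdifferentiable (by simp) (1 : G))
    (hγ 0).mdifferentiableAt (1 : ℝ)
  rw [hconst, mfderiv_const, hγ0] at h
  have e : (mulInvariantVectorField (I := 𝓘(ℝ, E)) v (γ 0) : E) = v := by
    rw [h0, mulInvariantVectorField_one]
  have h1 : ((1 : ℝ →L[ℝ] ℝ).smulRight (mulInvariantVectorField (I := 𝓘(ℝ, E)) v (γ 0) : E)) 1
      = v := by
    rw [e]
    exact one_smul ℝ v
  exact LinearMap.mem_ker.2 ((congrArg (projDeriv E F H 1) h1).symm.trans h.symm)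

variable [LieGroup 𝓘(ℝ, E) ∞ G]

/-- Near `π g` the translation `τ_a` factors as `π ∘ L_a ∘ s`, so its differentiability comes from
the local section. -/
theorem mdifferentiableAt_smul (hπ : ContMDiff 𝓘(ℝ, E) 𝓘(ℝ, F) ∞ (proj H)) {g : G}
    {s : G ⧸ H → G} (hs : IsHorizontalSectionAt (F := F) m g s) (a : G) :
    MDifferentiableAt 𝓘(ℝ, F) 𝓘(ℝ, F) (fun y : G ⧸ H ↦ a • y) (proj H g) := by
  have h : MDifferentiableAt 𝓘(ℝ, F) 𝓘(ℝ, F) (fun y : G ⧸ H ↦ proj H (a * s y)) (proj H g) :=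
    (hπ.mdifferentiable (by simp) _).comp _
      ((mdifferentiableAt_mul_left a (s (proj H g))).comp _ hs.mdifferentiableAt)
  refine h.congr_of_eventuallyEq ?_
  filter_upwards [hs.proj_section] with y hy
  conv_lhs => rw [← hy]
  rfl

/-- This is the derivative of `π ∘ L_a = τ_a ∘ π`. -/
theorem projDeriv_mul_left (hπ : ContMDiff 𝓘(ℝ, E) 𝓘(ℝ, F) ∞ (proj H))
    {a g b : G} (hb : a * g = b) {s : G ⧸ H → G} (hs : IsHorizontalSectionAt (F := F) m g s)
    (v : TangentSpace 𝓘(ℝ, E) g) :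
    (projDeriv E F H b (mfderiv 𝓘(ℝ, E) 𝓘(ℝ, E) (fun y : G ↦ a * y) g v : E) : F)
      = mfderiv 𝓘(ℝ, F) 𝓘(ℝ, F) (fun y : G ⧸ H ↦ a • y) (proj H g) (projDeriv E F H g v) := by
  have h₁ := mfderiv_comp_apply_of_base_eq hb (hπ.mdifferentiable (by simp) b)
    (mdifferentiableAt_mul_left a g) v
  have h₂ := mfderiv_comp_apply_of_base_eq rfl (mdifferentiableAt_smul hπ hs a)
    (hπ.mdifferentiable (by simp) g) v
  exact h₁.symm.trans h₂

theorem projDeriv_mulInvariantVectorField (hπ : ContMDiff 𝓘(ℝ, E) 𝓘(ℝ, F) ∞ (proj H))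
    {s : G ⧸ H → G} (hs : IsHorizontalSectionAt (F := F) m 1 s)
    (g : G) (u : GroupLieAlgebra 𝓘(ℝ, E) G) :
    (projDeriv E F H g (mulInvariantVectorField u g) : F)
      = mfderiv 𝓘(ℝ, F) 𝓘(ℝ, F) (fun y : G ⧸ H ↦ g • y) (proj H 1) (projDeriv E F H 1 u) :=
  projDeriv_mul_left hπ (mul_one g) hs u

theorem projDeriv_one_eq_zero_of_projDeriv_mulInvariantVectorField_eq_zero
    (hπ : ContMDiff 𝓘(ℝ, E) 𝓘(ℝ, F) ∞ (proj H)) {g : G}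
    {s : G ⧸ H → G} (hs : IsHorizontalSectionAt (F := F) m g s)
    {u : GroupLieAlgebra 𝓘(ℝ, E) G} (hu : projDeriv E F H g (mulInvariantVectorField u g) = 0) :
    projDeriv E F H 1 u = 0 := by
  have h := projDeriv_mul_left hπ (inv_mul_cancel g) hs (mulInvariantVectorField u g)
  rw [mfderiv_inv_mul_mulInvariantVectorField, hu, map_zero] at h
  exact h

/-- By equivariance, `π_* u = 0` at `1` forces `π_*` to kill the velocity of the one-parameter
subgroup of `u` at all times. Its image in the Hausdorff quotient is then a single point, so the
subgroup stays in `H`. -/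
theorem mem_subgroupLieAlgebra_of_projDeriv_one_eq_zero [CompleteSpace E] [T2Space G]
    [IsManifold 𝓘(ℝ, F) ∞ (G ⧸ H)] [T2Space (G ⧸ H)]
    (hπ : ContMDiff 𝓘(ℝ, E) 𝓘(ℝ, F) ∞ (proj H))
    {s : G ⧸ H → G} (hs : IsHorizontalSectionAt (F := F) m 1 s)
    {u : GroupLieAlgebra 𝓘(ℝ, E) G} (hu : projDeriv E F H 1 u = 0) :
    u ∈ subgroupLieAlgebra H := by
  obtain ⟨γ, h0, hγ⟩ := exists_isMIntegralCurve_mulInvariantVectorField u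
  refine Submodule.subset_span ⟨γ, h0, hγ, fun t ↦ ?_⟩
  have hc : ∀ t, HasMFDerivAt 𝓘(ℝ, ℝ) 𝓘(ℝ, F) (proj H ∘ γ) t 0 := by
    intro t
    have h := (hπ.mdifferentiable (by simp) (γ t)).hasMFDerivAt.comp t (hγ t)
    have e : (mfderiv 𝓘(ℝ, E) 𝓘(ℝ, F) (proj H) (γ t)).comp
        ((1 : ℝ →L[ℝ] ℝ).smulRight (mulInvariantVectorField (I := 𝓘(ℝ, E)) u (γ t))) = 0 := by
      refine (comp_one_smulRight (E := E) (F := F) _ _).trans ?_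
      have h1 := projDeriv_mulInvariantVectorField hπ hs (γ t) u
      rw [hu, map_zero] at h1
      exact (congrArg _ h1).trans (ContinuousLinearMap.smulRight_zero _)
    exact e ▸ h
  have h := eq_of_forall_hasMFDerivAt_zero hc 0 t
  rw [comp_apply, comp_apply, h0] at h
  simpa using QuotientGroup.eq.1 h

end Quotient

/-! ### Horizontal projection and lift as inverse constructions. -/

section HorizontalLift

variable {E : Type*} [NormedAddCommGroup E] [NormedSpace ℝ E]
  {F : Type*} [NormedAddCommGroup F] [NormedSpace ℝ F]
  {G : Type*} [TopologicalSpace G] [ChartedSpace E G] [Group G]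
  {H : Subgroup G} [ChartedSpace F (G ⧸ H)]
  {m : Submodule ℝ (GroupLieAlgebra 𝓘(ℝ, E) G)}

theorem IsHorizontalSectionAt.projDeriv_mfderiv
    (hπ : ContMDiff 𝓘(ℝ, E) 𝓘(ℝ, F) ∞ (proj H)) {g : G} {s : G ⧸ H → G}
    (hs : IsHorizontalSectionAt (F := F) m g s) (w : TangentSpace 𝓘(ℝ, F) (proj H g)) :
    (projDeriv E F H g (mfderiv 𝓘(ℝ, F) 𝓘(ℝ, E) s (proj H g) w : E) : F) = w := by
  have h := mfderiv_comp_apply_of_base_eq hs.section_proj (hπ.mdifferentiable (by simp) g)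
    hs.mdifferentiableAt w
  have hid : proj H ∘ s =ᶠ[𝓝 (proj H g)] id := hs.proj_section
  rw [hid.mfderiv_eq, mfderiv_id] at h
  exact h.symm

theorem IsHorizontalSectionAt.mfderiv_mem_horizontalSpace {g : G} {s : G ⧸ H → G}
    (hs : IsHorizontalSectionAt (F := F) m g s) (w : TangentSpace 𝓘(ℝ, F) (proj H g)) :
    (mfderiv 𝓘(ℝ, F) 𝓘(ℝ, E) s (proj H g) w : E) ∈ (horizontalSpace m g : Set E) := by
  obtain ⟨u, hu, h⟩ := hs.mfderiv_mem w
  refine ⟨u, hu, Eq.trans ?_ h⟩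
  rw [hs.section_proj]

theorem exists_mem_horizontalSpace_projDeriv_eq
    (hπ : ContMDiff 𝓘(ℝ, E) 𝓘(ℝ, F) ∞ (proj H)) {g : G} {s : G ⧸ H → G}
    (hs : IsHorizontalSectionAt (F := F) m g s) (w : TangentSpace 𝓘(ℝ, F) (proj H g)) :
    ∃ v ∈ horizontalSpace m g, projDeriv E F H g v = w :=
  ⟨_, hs.mfderiv_mem_horizontalSpace w, hs.projDeriv_mfderiv hπ w⟩

theorem horizontalLift_mem (g : G) (w : TangentSpace 𝓘(ℝ, F) (proj H g)) :
    horizontalLift (E := E) (H := H) m g w ∈ horizontalSpace m g :=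
  Subtype.coe_prop _

theorem projDeriv_horizontalLift
    (hπ : ContMDiff 𝓘(ℝ, E) 𝓘(ℝ, F) ∞ (proj H)) {g : G} {s : G ⧸ H → G}
    (hs : IsHorizontalSectionAt (F := F) m g s) (w : TangentSpace 𝓘(ℝ, F) (proj H g)) :
    projDeriv E F H g (horizontalLift (H := H) m g w) = w := by
  have : Nonempty (horizontalSpace m g) := ⟨⟨_, 0, m.zero_mem, rfl⟩⟩
  obtain ⟨v, hv, hvw⟩ := exists_mem_horizontalSpace_projDeriv_eq hπ hs w
  exact invFun_eq (f := fun v : horizontalSpace m g ↦ projDeriv E F H g v) ⟨⟨v, hv⟩, hvw⟩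

theorem horizontalProj_mem (hm : IsReductive H m) (g : G) (v : TangentSpace 𝓘(ℝ, E) g) :
    horizontalProj hm g v ∈ horizontalSpace m g :=
  ⟨_, Submodule.projection_apply_mem hm.isCompl _, rfl⟩

variable [LieGroup 𝓘(ℝ, E) ∞ G]

theorem projDeriv_mulInvariantVectorField_eq_zero
    (hπ : ContMDiff 𝓘(ℝ, E) 𝓘(ℝ, F) ∞ (proj H))
    {s : G ⧸ H → G} (hs : IsHorizontalSectionAt (F := F) m 1 s) (g : G)
    {u : GroupLieAlgebra 𝓘(ℝ, E) G} (hu : u ∈ subgroupLieAlgebra H) :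
    projDeriv E F H g (mulInvariantVectorField u g) = 0 := by
  have h := projDeriv_mulInvariantVectorField hπ hs g u
  rw [projDeriv_one_eq_zero_of_mem hπ hu, map_zero] at h
  exact h

theorem projDeriv_horizontalProj (hπ : ContMDiff 𝓘(ℝ, E) 𝓘(ℝ, F) ∞ (proj H))
    {s : G ⧸ H → G} (hs : IsHorizontalSectionAt (F := F) m 1 s) (hm : IsReductive H m) (g : G)
    (v : TangentSpace 𝓘(ℝ, E) g) :
    projDeriv E F H g (horizontalProj hm g v) = projDeriv E F H g v := by
  have key (u : GroupLieAlgebra 𝓘(ℝ, E) G) : projDeriv E F H g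
      (mulInvariantVectorField (m.projection (subgroupLieAlgebra H) hm.isCompl u) g)
        = projDeriv E F H g (mulInvariantVectorField u g) := by
    have h : invariantProjDeriv E F H g (u - m.projection (subgroupLieAlgebra H) hm.isCompl u) = 0 :=
      projDeriv_mulInvariantVectorField_eq_zero hπ hs g (Submodule.sub_projection_mem hm.isCompl u)
    rw [map_sub, sub_eq_zero] at h
    exact h.symm
  refine (key _).trans (congrArg _ ?_)
  exact mulInvariantVectorField_mfderiv_inv_mul g v

theorem starField_eq (hπ : ContMDiff 𝓘(ℝ, E) 𝓘(ℝ, F) ∞ (proj H))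
    {s₁ : G ⧸ H → G} (hs₁ : IsHorizontalSectionAt (F := F) m 1 s₁) (s : G ⧸ H → G)
    (A : GroupLieAlgebra 𝓘(ℝ, E) G) (x : G ⧸ H) :
    (starField s A x : F) = projDeriv E F H (s x) (mulInvariantVectorField A (s x)) :=
  (projDeriv_mulInvariantVectorField hπ hs₁ (s x) A).symm

/-- Along a section, `π_* Ã` is `A_*`. The base points `π (s x)` and `x` are only propositionally
equal, hence the formulation in the total space. -/
theorem projDeriv_mk_eq_starField_mk [IsManifold 𝓘(ℝ, F) ∞ (G ⧸ H)]
    (hπ : ContMDiff 𝓘(ℝ, E) 𝓘(ℝ, F) ∞ (proj H))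
    {s₁ : G ⧸ H → G} (hs₁ : IsHorizontalSectionAt (F := F) m 1 s₁) (s : G ⧸ H → G)
    (A : GroupLieAlgebra 𝓘(ℝ, E) G) {x : G ⧸ H} (hx : proj H (s x) = x) :
    (⟨proj H (s x), projDeriv E F H (s x) (mulInvariantVectorField A (s x))⟩ :
      TangentBundle 𝓘(ℝ, F) (G ⧸ H)) = ⟨x, starField s A x⟩ := by
  have h := starField_eq hπ hs₁ s A x
  have aux : ∀ {y : G ⧸ H} (_ : y = x) (a b : F), a = b →
      (⟨y, a⟩ : TangentBundle 𝓘(ℝ, F) (G ⧸ H)) = ⟨x, b⟩ := by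
    rintro y rfl a b rfl
    rfl
  exact aux hx _ _ h.symm

variable [CompleteSpace E] [T2Space G] [IsManifold 𝓘(ℝ, F) ∞ (G ⧸ H)] [T2Space (G ⧸ H)]

theorem eq_zero_of_projDeriv_mulInvariantVectorField_eq_zero
    (hπ : ContMDiff 𝓘(ℝ, E) 𝓘(ℝ, F) ∞ (proj H))
    (hs : ∀ g, ∃ s : G ⧸ H → G, IsHorizontalSectionAt (F := F) m g s) (hm : IsReductive H m)
    {g : G} {u : GroupLieAlgebra 𝓘(ℝ, E) G} (hu : u ∈ m)
    (h : projDeriv E F H g (mulInvariantVectorField u g) = 0) : u = 0 := by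
  obtain ⟨s₁, hs₁⟩ := hs 1
  obtain ⟨s, hs⟩ := hs g
  exact Submodule.disjoint_def.1 hm.isCompl.disjoint u hu
    (mem_subgroupLieAlgebra_of_projDeriv_one_eq_zero hπ hs₁
      (projDeriv_one_eq_zero_of_projDeriv_mulInvariantVectorField_eq_zero hπ hs h))

theorem injOn_projDeriv_horizontalSpace
    (hπ : ContMDiff 𝓘(ℝ, E) 𝓘(ℝ, F) ∞ (proj H))
    (hs : ∀ g, ∃ s : G ⧸ H → G, IsHorizontalSectionAt (F := F) m g s) (hm : IsReductive H m)
    (g : G) : InjOn (projDeriv E F H g) (horizontalSpace m g) := by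
  rintro _ ⟨u, hu, rfl⟩ _ ⟨v, hv, rfl⟩ h
  have h0 : invariantProjDeriv E F H g (u - v) = 0 := by
    rw [map_sub, sub_eq_zero]
    exact h
  rw [sub_eq_zero.1
    (eq_zero_of_projDeriv_mulInvariantVectorField_eq_zero hπ hs hm (m.sub_mem hu hv) h0)]

/-- Both vectors are horizontal and have the same image under `π_*`, which is injective on
horizontal vectors. -/
theorem horizontalLift_projDeriv
    (hπ : ContMDiff 𝓘(ℝ, E) 𝓘(ℝ, F) ∞ (proj H))
    (hs : ∀ g, ∃ s : G ⧸ H → G, IsHorizontalSectionAt (F := F) m g s) (hm : IsReductive H m)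
    (g : G) (v : TangentSpace 𝓘(ℝ, E) g) :
    horizontalLift (H := H) m g (projDeriv E F H g v) = horizontalProj hm g v := by
  refine injOn_projDeriv_horizontalSpace hπ hs hm g (horizontalLift_mem g _)
    (horizontalProj_mem hm g v) ?_
  rw [projDeriv_horizontalLift hπ (hs g).choose_spec,
    projDeriv_horizontalProj hπ (hs 1).choose_spec]

/-- A horizontal cross-section is tangent to every horizontal vector at its base point. -/
theorem IsHorizontalSectionAt.mfderiv_projDeriv
    (hπ : ContMDiff 𝓘(ℝ, E) 𝓘(ℝ, F) ∞ (proj H))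
    (hex : ∀ g, ∃ s : G ⧸ H → G, IsHorizontalSectionAt (F := F) m g s) (hm : IsReductive H m)
    {g : G} {s : G ⧸ H → G} (hs : IsHorizontalSectionAt (F := F) m g s)
    {v : TangentSpace 𝓘(ℝ, E) g} (hv : v ∈ horizontalSpace m g) :
    (mfderiv 𝓘(ℝ, F) 𝓘(ℝ, E) s (proj H g) (projDeriv E F H g v) : E) = v :=
  injOn_projDeriv_horizontalSpace hπ hex hm g (hs.mfderiv_mem_horizontalSpace _) hv
    (hs.projDeriv_mfderiv hπ _)

end HorizontalLift

/-! ### Vanishing of the second fundamental form on horizontal fields. -/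

section AffineSubmersion

variable {E : Type*} [NormedAddCommGroup E] [NormedSpace ℝ E] [FiniteDimensional ℝ E]
  {F : Type*} [NormedAddCommGroup F] [NormedSpace ℝ F] [FiniteDimensional ℝ F]
  {G : Type*} [TopologicalSpace G] [T2Space G] [ChartedSpace E G] [Group G]
  [LieGroup 𝓘(ℝ, E) ∞ G]
  {H : Subgroup G} [ChartedSpace F (G ⧸ H)] [IsManifold 𝓘(ℝ, F) ∞ (G ⧸ H)] [T2Space (G ⧸ H)]
  {m : Submodule ℝ (GroupLieAlgebra 𝓘(ℝ, E) G)}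

theorem secondFundForm_mulInvariantVectorField
    (hπ : ContMDiff 𝓘(ℝ, E) 𝓘(ℝ, F) ∞ (proj H)) (hm : IsReductive H m)
    {covG : AffineConnection E G} {covQ : AffineConnection F (G ⧸ H)}
    (haff : IsAffineSubmersion hm covG covQ) {g : G} {U : ∀ g : G, TangentSpace 𝓘(ℝ, E) g}
    (hU : U g ∈ horizontalSpace m g) {B : GroupLieAlgebra 𝓘(ℝ, E) G} (hB : B ∈ m) :
    secondFundForm covG covQ (proj H) U (mulInvariantVectorField B) g = 0 := by
  have : CompleteSpace E := FiniteDimensional.complete ℝ E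
  have hex : ∀ g, ∃ s : G ⧸ H → G, IsHorizontalSectionAt (F := F) m g s := fun g ↦
    (haff g).imp fun _ h ↦ h.1
  obtain ⟨s₁, hs₁⟩ := hex 1
  obtain ⟨s, hs, hcov⟩ := haff g
  obtain ⟨A, hA, hAU⟩ := hU
  have hB' : ContMDiff 𝓘(ℝ, E) 𝓘(ℝ, F).tangent 1 (fun g : G ↦
      (⟨proj H g, projDeriv E F H g (mulInvariantVectorField B g)⟩ :
        TangentBundle 𝓘(ℝ, F) (G ⧸ H))) := by
    have h : ContMDiff 𝓘(ℝ, E).tangent 𝓘(ℝ, F).tangent 1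
        (tangentMap 𝓘(ℝ, E) 𝓘(ℝ, F) (proj H)) :=
      hπ.contMDiff_tangentMap (by norm_cast)
    exact h.comp (contMDiff_mulInvariantVectorField_one B)
  have hZ : MDifferentiableAt 𝓘(ℝ, F) 𝓘(ℝ, F).tangent
      (fun x ↦ (⟨x, starField s B x⟩ : TangentBundle 𝓘(ℝ, F) (G ⧸ H))) (proj H g) := by
    refine ((hB'.mdifferentiable one_ne_zero _).comp _
      hs.mdifferentiableAt).congr_of_eventuallyEq ?_
    filter_upwards [hs.proj_section] with x hx
    exact (projDeriv_mk_eq_starField_mk hπ hs₁ s B hx).symm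
  have hWZ : ∀ᶠ x in 𝓝 (proj H g),
      (⟨proj H (s x), projDeriv E F H (s x) (mulInvariantVectorField B (s x))⟩ :
        TangentBundle 𝓘(ℝ, F) (G ⧸ H)) = ⟨x, starField s B x⟩ := by
    filter_upwards [hs.proj_section] with x hx
    exact projDeriv_mk_eq_starField_mk hπ hs₁ s B hx
  have hpull := pullbackCov_of_section covQ hs.mdifferentiableAt hs.section_proj
    (W := fun q ↦ projDeriv E F H q (mulInvariantVectorField B q))
    (mdifferentiableAt_fibreCoord (hB'.mdifferentiable one_ne_zero g)) hZ hWZ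
    (hs.mfderiv_projDeriv hπ hex hm ⟨A, hA, hAU⟩)
  -- The representative that `s` picks for the coset of `g` is `g` itself, so here `A_*` is the
  -- image of `Ã g = U g`.
  have hstar : starField s A (proj H g) = projDeriv E F H g (U g) := by
    have h := starField_eq hπ hs₁ s A (proj H g)
    rw [hs.section_proj] at h
    rw [← hAU]
    exact h
  -- Applying `π_*` removes the horizontal projection on the left and the lift on the right of the
  -- affine condition.
  have h := congrArg (projDeriv E F H g) (hcov A hA B hB)
  rw [projDeriv_horizontalProj hπ hs₁, projDeriv_horizontalLift hπ hs, hstar, hAU] at h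
  exact (congrArg₂ (· - ·) hpull h).trans (sub_self _)

theorem secondFundForm_eq_zero
    (hπ : ContMDiff 𝓘(ℝ, E) 𝓘(ℝ, F) ∞ (proj H)) (hm : IsReductive H m)
    {covG : AffineConnection E G} {covQ : AffineConnection F (G ⧸ H)}
    (haff : IsAffineSubmersion hm covG covQ) {g : G} {U V : ∀ g : G, TangentSpace 𝓘(ℝ, E) g}
    (hVd : MDifferentiableAt 𝓘(ℝ, E) 𝓘(ℝ, E).tangent
      (fun g ↦ (⟨g, V g⟩ : TangentBundle 𝓘(ℝ, E) G)) g)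
    (hU : U g ∈ horizontalSpace m g) (hV : V g ∈ horizontalSpace m g) :
    secondFundForm covG covQ (proj H) U V g = 0 := by
  obtain ⟨B, hB, hBV⟩ := hV
  rw [(tensorialAt_secondFundForm covG covQ hπ U g).pointwise hVd
    ((contMDiff_mulInvariantVectorField_one B).mdifferentiable one_ne_zero g) hBV.symm]
  exact secondFundForm_mulInvariantVectorField hπ hm haff hU hB

end AffineSubmersion

/-! ### Differentiability of horizontal lifts. -/

section LiftDifferentiable

variable {E : Type*} [NormedAddCommGroup E] [NormedSpace ℝ E]
  {F : Type*} [NormedAddCommGroup F] [NormedSpace ℝ F]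
  {G : Type*} [TopologicalSpace G] [ChartedSpace E G] [Group G]
  {H : Subgroup G} [ChartedSpace F (G ⧸ H)]
  {m : Submodule ℝ (GroupLieAlgebra 𝓘(ℝ, E) G)}

theorem sum_smul_mulInvariantVectorField {ι : Type*} [Fintype ι]
    (b : ι → GroupLieAlgebra 𝓘(ℝ, E) G) (c : ι → ℝ) (q : G) :
    ∑ i, c i • mulInvariantVectorField (I := 𝓘(ℝ, E)) (b i) q
      = mulInvariantVectorField (∑ i, c i • b i) q := by
  have h : (mfderiv 𝓘(ℝ, E) 𝓘(ℝ, E) (fun y : G ↦ q * y) 1 : E →L[ℝ] E)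
      (∑ i, c i • (b i : E)) = ∑ i, c i • (mfderiv 𝓘(ℝ, E) 𝓘(ℝ, E) (fun y : G ↦ q * y) 1 :
        E →L[ℝ] E) (b i : E) := by
    simp only [map_sum, map_smul]
  exact h.symm

variable [LieGroup 𝓘(ℝ, E) ∞ G]

theorem mdifferentiableAt_sum_smul_mulInvariantVectorField {ι : Type*} [Fintype ι]
    (b : ι → GroupLieAlgebra 𝓘(ℝ, E) G) {c : G → ι → ℝ} {g : G}
    (hc : MDifferentiableAt 𝓘(ℝ, E) 𝓘(ℝ, ι → ℝ) c g) :
    MDifferentiableAt 𝓘(ℝ, E) 𝓘(ℝ, E).tangent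
      (fun q ↦ (⟨q, ∑ i, c q i • mulInvariantVectorField (I := 𝓘(ℝ, E)) (b i) q⟩ :
        TangentBundle 𝓘(ℝ, E) G)) g := by
  have h (i : ι) := ((contMDiff_mulInvariantVectorField_one (b i)).mdifferentiable one_ne_zero g)
  have hci (i : ι) : MDifferentiableAt 𝓘(ℝ, E) 𝓘(ℝ, ℝ) (fun q ↦ c q i) g :=
    ((ContinuousLinearMap.proj (R := ℝ) (φ := fun _ : ι ↦ ℝ) i).mdifferentiableAt).comp g hc
  exact .sum_section fun i _ ↦ (hci i).smul_section (h i)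

/-- In the left invariant frame coming from a basis of `𝔪`, the coefficients of the lift solve an
invertible linear system whose matrix and right-hand side depend differentiably on the point. -/
theorem mdifferentiableAt_horizontalLiftField [FiniteDimensional ℝ E] [T2Space G]
    [IsManifold 𝓘(ℝ, F) ∞ (G ⧸ H)] [T2Space (G ⧸ H)]
    (hπ : ContMDiff 𝓘(ℝ, E) 𝓘(ℝ, F) ∞ (proj H))
    (hex : ∀ g, ∃ s : G ⧸ H → G, IsHorizontalSectionAt (F := F) m g s) (hm : IsReductive H m)
    {Y : ∀ x : G ⧸ H, TangentSpace 𝓘(ℝ, F) x} {g : G}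
    (hY : MDifferentiableAt 𝓘(ℝ, F) 𝓘(ℝ, F).tangent
      (fun x ↦ (⟨x, Y x⟩ : TangentBundle 𝓘(ℝ, F) (G ⧸ H))) (proj H g)) :
    MDifferentiableAt 𝓘(ℝ, E) 𝓘(ℝ, E).tangent
      (fun q ↦ (⟨q, horizontalLiftField (H := H) m Y q⟩ : TangentBundle 𝓘(ℝ, E) G)) g := by
  have : CompleteSpace E := FiniteDimensional.complete ℝ E
  have : FiniteDimensional ℝ (GroupLieAlgebra 𝓘(ℝ, E) G) := ‹FiniteDimensional ℝ E›
  let b := Module.finBasis ℝ m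
  let e := trivializationAt F (fun y : G ⧸ H ↦ TangentSpace 𝓘(ℝ, F) y) (proj H g)
  let W (i : Fin (Module.finrank ℝ m)) (q : G) : TangentSpace 𝓘(ℝ, F) (proj H q) :=
    projDeriv E F H q (mulInvariantVectorField (b i : GroupLieAlgebra 𝓘(ℝ, E) G) q)
  -- `L q` sends coefficients `x` to the fibre coordinate of `π_* (∑ xᵢ b̃ᵢ)` at `q`; all `L q`
  -- share a fixed domain and codomain, so `L` can be differentiated.
  let L (q : G) : (Fin (Module.finrank ℝ m) → ℝ) →L[ℝ] F :=
    ∑ i, (ContinuousLinearMap.proj i).smulRight (fibreCoord (proj H) (W i) (proj H g) q)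
  have hW (i) : MDifferentiableAt 𝓘(ℝ, E) 𝓘(ℝ, F) (fibreCoord (proj H) (W i) (proj H g)) g :=
    mdifferentiableAt_fibreCoord (mdifferentiableAt_mfderiv_apply hπ
      ((contMDiff_mulInvariantVectorField_one _).mdifferentiable one_ne_zero g))
  have hLd : MDifferentiableAt 𝓘(ℝ, E) 𝓘(ℝ, (Fin (Module.finrank ℝ m) → ℝ) →L[ℝ] F) L g := by
    have h (i) := (((ContinuousLinearMap.smulRightL ℝ (Fin (Module.finrank ℝ m) → ℝ) F)
      (ContinuousLinearMap.proj i)).mdifferentiableAt).comp g (hW i)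
    have hs := MDifferentiableAt.sum (t := Finset.univ) fun i _ ↦ h i
    convert! hs using 1
    funext q
    simp [L]
  let y (q : G) : F := fibreCoord (proj H) (fun q ↦ Y (proj H q)) (proj H g) q
  have hy : MDifferentiableAt 𝓘(ℝ, E) 𝓘(ℝ, F) y g :=
    mdifferentiableAt_fibreCoord (hY.comp g (hπ.mdifferentiable (by simp) g))
  have hT {q : G} (hq : proj H q ∈ e.baseSet) (w : TangentSpace 𝓘(ℝ, F) (proj H q)) :
      e.continuousLinearMapAt ℝ (proj H q) w = (e ⟨proj H q, w⟩).2 := by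
    rw [Bundle.Trivialization.continuousLinearMapAt_apply,
      Bundle.Trivialization.linearMapAt_apply, if_pos hq]
  have hTinj {q : G} (hq : proj H q ∈ e.baseSet) :
      Injective (e.continuousLinearMapAt ℝ (proj H q)) :=
    LeftInverse.injective (g := e.symmL ℝ (proj H q)) (e.symmL_continuousLinearMapAt hq)
  have hL {q : G} (hq : proj H q ∈ e.baseSet) (x : Fin (Module.finrank ℝ m) → ℝ) :
      L q x = e.continuousLinearMapAt ℝ (proj H q)
        (projDeriv E F H q (∑ i, x i •
          mulInvariantVectorField (b i : GroupLieAlgebra 𝓘(ℝ, E) G) q)) := by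
    have hW' (i) : fibreCoord (proj H) (W i) (proj H g) q
        = e.continuousLinearMapAt ℝ (proj H q) (W i q) := (hT hq (W i q)).symm
    simp only [L, hW', sum_apply, ContinuousLinearMap.smulRight_apply,
      ContinuousLinearMap.proj_apply, map_sum, map_smul, W]
  have hbij {q : G} (hq : proj H q ∈ e.baseSet) : Bijective (L q) := by
    constructor
    · refine (injective_iff_map_eq_zero _).2 fun x hx ↦ ?_
      rw [hL hq, sum_smul_mulInvariantVectorField] at hx
      have h0 := hTinj hq (hx.trans (map_zero _).symm)
      have h1 := eq_zero_of_projDeriv_mulInvariantVectorField_eq_zero hπ hex hm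
        (m.sum_mem fun i _ ↦ m.smul_mem (x i) (b i).2) h0
      have h2 : ∑ i, x i • b i = 0 := Subtype.ext (by simpa using h1)
      exact funext (Fintype.linearIndependent_iff.1 b.linearIndependent x h2)
    · intro w
      obtain ⟨_, ⟨u, hu, rfl⟩, huw⟩ := exists_mem_horizontalSpace_projDeriv_eq hπ
        (hex q).choose_spec (e.symmL ℝ (proj H q) w)
      refine ⟨b.equivFun ⟨u, hu⟩, ?_⟩
      rw [hL hq, sum_smul_mulInvariantVectorField]
      have h1 : ∑ i, b.equivFun ⟨u, hu⟩ i • (b i : GroupLieAlgebra 𝓘(ℝ, E) G) = u := by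
        have := congrArg Subtype.val (b.sum_equivFun ⟨u, hu⟩)
        simpa only [AddSubmonoidClass.coe_finsetSum, Submodule.coe_smul] using this
      rw [h1, huw, e.continuousLinearMapAt_symmL hq]
  have hnhds : ∀ᶠ q in 𝓝 g, proj H q ∈ e.baseSet :=
    hπ.continuous.continuousAt (e.open_baseSet.mem_nhds
      (FiberBundle.mem_baseSet_trivializationAt F _ (proj H g)))
  have hinv {q : G} (hq : proj H q ∈ e.baseSet) : (L q).IsInvertible :=
    ⟨(LinearEquiv.ofBijective (L q).toLinearMap (hbij hq)).toContinuousLinearEquiv, by ext; rfl⟩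
  have hc : MDifferentiableAt 𝓘(ℝ, E) 𝓘(ℝ, Fin (Module.finrank ℝ m) → ℝ)
      (fun q ↦ (L q).inverse (y q)) g := by
    -- Inversion of operators is differentiable at an invertible one.
    have h1 := ((hinv hnhds.self_of_nhds).contDiffAt_map_inverse (n := 1)).differentiableAt
      one_ne_zero
    exact (h1.comp_mdifferentiableAt hLd).clm_apply hy
  refine (mdifferentiableAt_sum_smul_mulInvariantVectorField
    (fun i ↦ (b i : GroupLieAlgebra 𝓘(ℝ, E) G)) hc).congr_of_eventuallyEq ?_
  filter_upwards [hnhds] with q hq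
  congr 1
  -- The frame combination with coefficients `(L q)⁻¹ (y q)` is horizontal and projects to `Y`, so
  -- it is the lift.
  refine injOn_projDeriv_horizontalSpace hπ hex hm q (horizontalLift_mem q _) ?_ ?_
  · rw [sum_smul_mulInvariantVectorField]
    exact ⟨_, m.sum_mem fun i _ ↦ m.smul_mem _ (b i).2, rfl⟩
  · refine (projDeriv_horizontalLift hπ (hex q).choose_spec _).trans (hTinj hq ?_)
    rw [← hL hq, (hinv hq).self_apply_inverse]
    exact hT hq _

end LiftDifferentiable

end ReductiveSpace

theorem mainTheorem8
    {E : Type*} [NormedAddCommGroup E] [NormedSpace ℝ E] [FiniteDimensional ℝ E]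
    {F : Type*} [NormedAddCommGroup F] [NormedSpace ℝ F] [FiniteDimensional ℝ F]
    {G : Type*} [TopologicalSpace G] [T2Space G] [ChartedSpace E G] [Group G]
    [LieGroup 𝓘(ℝ, E) ∞ G]
    (H : Subgroup G) (hH : IsClosed (H : Set G))
    [ChartedSpace F (G ⧸ H)] [IsManifold 𝓘(ℝ, F) ∞ (G ⧸ H)]
    (hπ : Manifold.IsSubmersion 𝓘(ℝ, E) 𝓘(ℝ, F) ∞ (proj H))
    (m : Submodule ℝ (GroupLieAlgebra 𝓘(ℝ, E) G)) (hm : IsReductive H m)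
    (covG : AffineConnection E G) [CovariantDerivative.ContMDiffCovariantDerivative covG ∞]
    (covQ : AffineConnection F (G ⧸ H)) [CovariantDerivative.ContMDiffCovariantDerivative covQ ∞]
    (haff : IsAffineSubmersion hm covG covQ) :
    (∀ X Y : (x : G ⧸ H) → TangentSpace 𝓘(ℝ, F) x,
      ContMDiff 𝓘(ℝ, F) 𝓘(ℝ, F).tangent ∞ (fun x ↦ (⟨x, X x⟩ : TangentBundle 𝓘(ℝ, F) (G ⧸ H))) →
      ContMDiff 𝓘(ℝ, F) 𝓘(ℝ, F).tangent ∞ (fun x ↦ (⟨x, Y x⟩ : TangentBundle 𝓘(ℝ, F) (G ⧸ H))) →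
      ∀ g : G,
        horizontalProj hm g
            (covG (horizontalLiftField (H := H) m Y) g (horizontalLiftField (H := H) m X g))
          = horizontalLift (H := H) m g (covQ Y (proj H g) (X (proj H g)))) ∧
    (∀ U V : (g : G) → TangentSpace 𝓘(ℝ, E) g,
      ContMDiff 𝓘(ℝ, E) 𝓘(ℝ, E).tangent ∞ (fun g ↦ (⟨g, U g⟩ : TangentBundle 𝓘(ℝ, E) G)) →
      ContMDiff 𝓘(ℝ, E) 𝓘(ℝ, E).tangent ∞ (fun g ↦ (⟨g, V g⟩ : TangentBundle 𝓘(ℝ, E) G)) →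
      (∀ g, U g ∈ horizontalSpace m g) → (∀ g, V g ∈ horizontalSpace m g) →
      ∀ g : G, secondFundForm covG covQ (proj H) U V g = 0) := by
  have : CompleteSpace E := FiniteDimensional.complete ℝ E
  have : IsTopologicalGroup G := topologicalGroup_of_lieGroup 𝓘(ℝ, E) ∞
  have : T2Space (G ⧸ H) := t2Space_quotient hH
  have hπ := hπ.contMDiff
  have hex : ∀ g, ∃ s : G ⧸ H → G, IsHorizontalSectionAt (F := F) m g s := fun g ↦
    (haff g).imp fun _ h ↦ h.1
  refine ⟨fun X Y hX hY g ↦ ?_, fun U V _ hV hU' hV' g ↦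
    secondFundForm_eq_zero hπ hm haff (hV.mdifferentiable (by simp) g) (hU' g) (hV' g)⟩
  have hYd := hY.mdifferentiable (by simp) (proj H g)
  have hβ := secondFundForm_eq_zero hπ hm haff
    (U := horizontalLiftField (H := H) m X)
    (mdifferentiableAt_horizontalLiftField hπ hex hm hYd)
    (horizontalLift_mem g _) (horizontalLift_mem g _)
  -- As `π_* Y^h = Y ∘ π`, the pull-back term of `β` is the derivative of `Y` in the direction `π_*
  -- X^h = X ∘ π`.
  have hW : (fun q ↦ mfderiv 𝓘(ℝ, E) 𝓘(ℝ, F) (proj H) q (horizontalLiftField (H := H) m Y q))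
      = fun q ↦ Y (proj H q) :=
    funext fun q ↦ projDeriv_horizontalLift hπ (hex q).choose_spec _
  rw [secondFundForm, hW, pullbackCov_comp covQ (hπ.mdifferentiable (by simp) g) hYd,
    sub_eq_zero] at hβ
  -- Writing `𝐡` as the lift of `π_*` reduces the claim to an equation on `G ⧸ H`, which is the
  -- vanishing of `β`.
  rw [← horizontalLift_projDeriv hπ hex hm]
  refine congrArg (horizontalLift (H := H) m g) (hβ.symm.trans (congrArg _ ?_))
  exact projDeriv_horizontalLift hπ (hex g).choose_spec _
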